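/- Let $\Gamma=(V,E,\ell)$ be a finite simplicial graph whose edges carry even labels $\ell(e)=2\tilde\ell(e)$, $\tilde\ell(e)\ge 1$, and let $A_\Gamma=\langle g_v,\ v\in V \mid (g_vg_w)^{\tilde\ell(e)}=(g_wg_v)^{\tilde\ell(e)},\ e=\{v,w\}\in E\rangle$ be the associated even Artin-Tits group. Let $\chi:A_\Gamma\to\mathbb{Z}$ be any nonzero homomorphism, put $m_v=\chi(g_v)$, and let $A_\Gamma^\chi=\ker\chi$. Let $\mathbb{K}$ be a field of arbitrary characteristic. Regard $H_1(A_\Gamma^\chi;\mathbb{K})$ as a $\mathbb{K}[t^{\pm1}]$-module, where $t$ acts by conjugation by an element $g\in A_\Gamma$ for which $\chi(g)$ generates the image of $\chi$. Define $V_{\mathcal R}=\{v\in V\mid m_v=0\}$ and $E_{\mathcal R}=\{e=\{v,w\}\in E\mid m_v+m_w=0 \text{ and } \tilde\ell(e)\cdot 1_{\mathbb K}=0\}$. Let $\Gamma_1$ be the graph obtained from $\Gamma$ by deleting the (open) edges $e=\{v,w\}$ for which either $v,w\in V_{\mathcal R}$ or $e\in E_{\mathcal R}$, and deleting the vertices $v\in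 V_{\mathcal R}$ that are adjacent in $\Gamma$ to some vertex of $V\setminus V_{\mathcal R}$ (together with the edges at them). Theorem. The $\mathbb{K}[t^{\pm1}]$-module $H_1(A_\Gamma^\chi;\mathbb{K})$ is finitely generated, and its free part, the quotient by its torsion submodule, is a free module of rank $\dim_{\mathbb K}\tilde H_0(\Gamma_1;\mathbb{K})$. In particular, $H_1(A_\Gamma^\chi;\mathbb{K})$ is a torsion module if and only if $\Gamma_1$ is connected. -/

import Mathlib

universe u

noncomputable section

/-! ### Labelled graphs and Artin-Tits groups -/

/-- A labelled simplicial graph: every edge carries an integer label at least two. -/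
structure LabeledGraph (V : Type u) where
  graph : SimpleGraph V
  label : graph.edgeSet → ℕ
  two_le_label : ∀ e, 2 ≤ label e

namespace LabeledGraph

variable {V : Type u} (Γ : LabeledGraph V)

/-- All labels are even. -/
def IsEven : Prop := ∀ e, Even (Γ.label e)

/-- The alternating word `v w v w ⋯` of length `n`: it is `(v w)^k` if `n = 2 k` and
`(v w)^k v` if `n = 2 k + 1`. -/
def alternatingWord (v w : V) (n : ℕ) : FreeGroup V :=
  (FreeGroup.of v * FreeGroup.of w) ^ (n / 2) * (if Even n then 1 else FreeGroup.of v)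

/-- For each edge `{v, w}` with label `n`, the relation equating the two alternating words of
length `n` in `v` and `w`. -/
def artinRelators : Set (FreeGroup V) :=
  {r | ∃ (v w : V) (h : Γ.graph.Adj v w),
    r = alternatingWord v w (Γ.label ⟨s(v, w), h⟩) *
      (alternatingWord w v (Γ.label ⟨s(v, w), h⟩))⁻¹}

/-- The Artin-Tits group of a labelled graph. -/
abbrev ArtinGroup : Type u := PresentedGroup Γ.artinRelators

/-- The standard generator attached to a vertex. -/
def gen (v : V) : Γ.ArtinGroup := PresentedGroup.of v

/-! ### Resonance and the reduced graph -/

variable (χ : Γ.ArtinGroup →* Multiplicative ℤ)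

/-- The integer `m_v`, the value of the character on the standard generator of `v`. -/
def vertexWeight (v : V) : ℤ := (χ (Γ.gen v)).toAdd

/-- The integer `m_e = m_v + m_w` for `e = {v, w}`. -/
def edgeWeight : Sym2 V → ℤ :=
  Sym2.lift ⟨fun v w => Γ.vertexWeight χ v + Γ.vertexWeight χ w, fun _ _ => add_comm _ _⟩

/-- The resonant vertices: those with `m_v = 0`. -/
def resonantVertices : Set V := {v | Γ.vertexWeight χ v = 0}

/-- The resonant edges over `K`: those with `m_e = 0` whose half label vanishes in `K`. -/
def resonantEdges (K : Type u) [Field K] : Set (Sym2 V) :=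
  {e | ∃ h : e ∈ Γ.graph.edgeSet,
    Γ.edgeWeight χ e = 0 ∧ ((Γ.label ⟨e, h⟩ / 2 : ℕ) : K) = 0}

/-- The resonant vertices that are adjacent to some non-resonant vertex. -/
def deletedVertices : Set V :=
  {v | v ∈ Γ.resonantVertices χ ∧ ∃ w, w ∉ Γ.resonantVertices χ ∧ Γ.graph.Adj v w}

/-- The edges that are resonant over `K` or have both ends resonant. -/
def deletedEdges (K : Type u) [Field K] : Set (Sym2 V) :=
  Γ.resonantEdges χ K ∪ {e | ∀ v ∈ e, v ∈ Γ.resonantVertices χ}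

/-- The graph `Γ₁`: delete from `Γ` the edges in `deletedEdges` (keeping their end points), then
the vertices in `deletedVertices` together with the edges at them. -/
def reducedGraph (K : Type u) [Field K] :
    SimpleGraph ((Γ.deletedVertices χ)ᶜ : Set V) :=
  (Γ.graph.deleteEdges (Γ.deletedEdges χ K)).induce (Γ.deletedVertices χ)ᶜ

end LabeledGraph

/-! ### Reduced homology of a graph in degree zero -/

/-- The homology of `A → B → C` at `B`: the kernel of the second map modulo the (part in that kernel
of the) image of the first map. -/
abbrev HomologyAt {K A B C : Type u} [Field K] [AddCommGroup A] [AddCommGroup B] [AddCommGroup C]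
    [Module K A] [Module K B] [Module K C] (f : A →ₗ[K] B) (g : B →ₗ[K] C) : Type u :=
  LinearMap.ker g ⧸ (LinearMap.range f).submoduleOf (LinearMap.ker g)

namespace SimpleGraph

variable {W : Type u} (G : SimpleGraph W) (K : Type u) [Field K]

/-- The simplicial boundary, sending an oriented edge from `v` to `w` to `w - v`. Both orientations
of an edge are present as generators; their boundaries are opposite, so the image is that of the
simplicial chain complex for any choice of orientations. -/
def boundaryOne : (G.Dart →₀ K) →ₗ[K] (W →₀ K) :=
  Finsupp.lsum K fun d => Finsupp.lsingle d.snd - Finsupp.lsingle d.fst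

/-- The augmentation, sending each vertex to `1`. -/
def augmentation (W : Type u) (K : Type u) [Field K] : (W →₀ K) →ₗ[K] K :=
  Finsupp.lsum K fun _ => LinearMap.id

/-- Reduced homology in degree zero: the homology at the middle term of the augmented chain complex
`C₁ → C₀ → K`. -/
abbrev ReducedHomologyZero : Type u :=
  HomologyAt (G.boundaryOne K) (augmentation W K)

end SimpleGraph

/-! ### Laurent polynomial modules -/

section LaurentModule

variable {K M : Type u} [Field K] [AddCommGroup M] [Module K M]

/-- The action of `K[t, t⁻¹]` on `M` for which `t` acts by the automorphism `φ`. -/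
def laurentAction (φ : M ≃ₗ[K] M) : LaurentPolynomial K →ₐ[K] Module.End K M :=
  AddMonoidAlgebra.lift K (Module.End K M) ℤ
    ((Units.coeHom (Module.End K M)).comp
      (zpowersHom _ ((LinearMap.GeneralLinearGroup.generalLinearEquiv K M).symm φ)))

/-- The `K`-vector space `M`, regarded as a `K[t, t⁻¹]`-module in which `t` acts by `φ`. -/
def LaurentModule (_φ : M ≃ₗ[K] M) : Type u := M

instance (φ : M ≃ₗ[K] M) : AddCommGroup (LaurentModule φ) := inferInstanceAs (AddCommGroup M)

instance (φ : M ≃ₗ[K] M) : Module (LaurentPolynomial K) (LaurentModule φ) :=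
  Module.compHom M (laurentAction φ).toRingHom

theorem LaurentModule.smul_def (φ : M ≃ₗ[K] M) (p : LaurentPolynomial K) (x : LaurentModule φ) :
    p • x = (laurentAction φ p : M →ₗ[K] M) x := rfl

theorem LaurentModule.T_smul (φ : M ≃ₗ[K] M) (x : LaurentModule φ) :
    (LaurentPolynomial.T 1 : LaurentPolynomial K) • x = φ x := by
  have h : laurentAction φ (LaurentPolynomial.T 1) = φ.toLinearMap := by
    rw [laurentAction, LaurentPolynomial.T, AddMonoidAlgebra.lift_single]
    simp
    rfl
  exact LinearMap.congr_fun h x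

theorem LaurentModule.C_smul (φ : M ≃ₗ[K] M) (a : K) (x : LaurentModule φ) :
    LaurentPolynomial.C a • x = ((a • LinearMap.id : M →ₗ[K] M) x : M) := by
  have h : laurentAction φ (LaurentPolynomial.C a) = a • LinearMap.id := by
    rw [LaurentPolynomial.C_eq_algebraMap, AlgHom.commutes]
    rfl
  exact LinearMap.congr_fun h x

end LaurentModule

/-! ### Homology of a normal subgroup with the conjugation action -/

section ConjugationHomology

variable {G : Type u} [Group G] (N : Subgroup G) [N.Normal] (K : Type u) [Field K]

/-- The automorphism of `H_n(N; K)` (trivial coefficients) induced by the conjugation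
`x ↦ g x g⁻¹` of the normal subgroup `N` and the identity of `K`. -/
def conjHomologyEquiv (g : G) (n : ℕ) :
    groupHomology (Rep.trivial K N K) n ≃ₗ[K] groupHomology (Rep.trivial K N K) n :=
  (groupHomology.mapIso (A := Rep.trivial K N K) (B := Rep.trivial K N K)
    (MulAut.conjNormal g : N ≃* N) (LinearEquiv.refl K K) (fun _ => rfl) n).toLinearEquiv

/-- The group homology `H_n(ker χ; K)`, regarded as a `K[t, t⁻¹]`-module in which `t` acts by
conjugation by `g`. -/
abbrev KernelHomology {G : Type u} [Group G] (χ : G →* Multiplicative ℤ) (K : Type u) [Field K]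
    (g : G) (n : ℕ) : Type u :=
  LaurentModule (conjHomologyEquiv χ.ker K g n)

end ConjugationHomology

end

noncomputable section

/-! ### Modules over Laurent polynomials -/

/-! Let `R = K[t, t⁻¹]`, a principal ideal domain with fraction field `F`, and let `H` be the first
homology of the kernel. Finite generation of `H` follows from that of the group
(`KernelHomology.finite`), and the rank of the free part is the dimension of `Hom_R(H, F)`.

Let the group act on `F` through `τ = t^e`, where `e` is `χ` divided by a generator of its image.
Linear forms on `H` are crossed homomorphisms modulo principal ones, and the latter form a line
because `t ≠ 1`. So crossed homomorphisms have dimension rank plus one (`finrank_crossedHoms`).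

A crossed homomorphism is a lift of `τ` to affine maps, hence is determined by its values `x_v` on
generators. The relation of an edge `{v, w}` says that a geometric sum in `τ_v τ_w` vanishes or `(1
- τ_w) x_v = (1 - τ_v) x_w` (`mem_range_crossedHomValues_iff`). Since `t` is not a root of unity,
the sum vanishes exactly on resonant edges. On the other edges, `x_v / (1 - τ_v)` is constant
between non-resonant vertices, `x_v = 0` at a resonant vertex with a non-resonant neighbour, and two
resonant ends impose nothing. The solutions are thus the functions on the components of `Γ₁`
(`mem_range_componentValues_iff`), whose number is one more than the dimension of reduced `H₀`. -/

theorem IsLocalization.isPrincipalIdealRing_of_isPrincipalIdealRing {R : Type*} [CommRing R]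
    (S : Submonoid R) (A : Type*) [CommRing A] [Algebra R A] [IsLocalization S A]
    [IsPrincipalIdealRing R] : IsPrincipalIdealRing A where
  principal I := by
    rw [← IsLocalization.map_under S A I]
    infer_instance

namespace LaurentPolynomial

variable (K : Type*) [Field K]

instance : IsDomain (LaurentPolynomial K) :=
  IsLocalization.isDomain_of_le_nonZeroDivisors (M := Submonoid.powers (Polynomial.X : Polynomial K))
    (LaurentPolynomial K) (powers_le_nonZeroDivisors_of_noZeroDivisors Polynomial.X_ne_zero)

instance : IsPrincipalIdealRing (LaurentPolynomial K) :=
  IsLocalization.isPrincipalIdealRing_of_isPrincipalIdealRing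
    (Submonoid.powers (Polynomial.X : Polynomial K)) _

end LaurentPolynomial

/-- The linear forms on a finite module over a principal ideal domain, with values in the fraction
field, form a vector space of dimension the rank of the module. -/
theorem nonempty_hom_linearEquiv (R M F : Type*) [CommRing R] [IsDomain R]
    [IsPrincipalIdealRing R] [AddCommGroup M] [Module R M] [Module.Finite R M] [Field F]
    [Algebra R F] [IsFractionRing R F] :
    Nonempty ((M →ₗ[R] F) ≃ₗ[F]
      (Fin (Module.finrank R (M ⧸ Submodule.torsion R M)) → F)) := by
  -- A form with values in a field containing `R` kills torsion, so it factors through the free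
  -- quotient.
  have e : ((M ⧸ Submodule.torsion R M) →ₗ[R] F) ≃ₗ[F] (M →ₗ[R] F) :=
    LinearEquiv.ofBijective
      { toFun f := f ∘ₗ (Submodule.torsion R M).mkQ
        map_add' _ _ := rfl
        map_smul' _ _ := rfl }
      ⟨fun f f' h => by
        ext x
        exact LinearMap.congr_fun h x,
       fun f => ⟨(Submodule.torsion R M).liftQ f (by
          intro x hx
          obtain ⟨a, ha⟩ := hx
          have := congrArg f ha
          rw [Submonoid.smul_def, map_smul, map_zero] at this
          rw [LinearMap.mem_ker]
          have h0 : (a : R) ≠ 0 := nonZeroDivisors.coe_ne_zero a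
          rw [Algebra.smul_def, mul_eq_zero] at this
          refine this.resolve_left ?_
          rwa [FaithfulSMul.algebraMap_eq_zero_iff]),
        by ext x; rfl⟩⟩
  exact ⟨e.symm.trans ((Module.finBasis R (M ⧸ Submodule.torsion R M)).constr F).symm⟩

theorem isTorsion_iff_finrank_quotient_torsion_eq_zero (R M : Type*) [CommRing R] [IsDomain R]
    [IsPrincipalIdealRing R] [AddCommGroup M] [Module R M] [Module.Finite R M] :
    Module.IsTorsion R M ↔ Module.finrank R (M ⧸ Submodule.torsion R M) = 0 := by
  have : Module.Free R (M ⧸ Submodule.torsion R M) := inferInstance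
  rw [Module.finrank_eq_zero_iff_of_free, Submodule.Quotient.subsingleton_iff,
    ← Submodule.isTorsion'_iff_torsion'_eq_top]

/-! ### First homology with trivial coefficients -/

namespace groupHomology

variable {N : Type u} [Group N] (K : Type u) [Field K]

/-- The class in `H₁(N; K)` of an element of `N`. -/
def elementClass (x : N) : groupHomology (Rep.trivial K N K) 1 :=
  H1π (Rep.trivial K N K) ((cycles₁IsoOfIsTrivial (Rep.trivial K N K)).inv (Finsupp.single x 1))

/-- The linear map from the chains to `H₁(N; K)`. -/
def chainsToH1 : (N →₀ K) →ₗ[K] groupHomology (Rep.trivial K N K) 1 :=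
  (H1π (Rep.trivial K N K)).hom ∘ₗ (cycles₁IsoOfIsTrivial (Rep.trivial K N K)).inv.hom

theorem chainsToH1_surjective : Function.Surjective (chainsToH1 (N := N) K) := by
  have h : Function.Surjective (H1π (Rep.trivial K N K)) :=
    (ModuleCat.epi_iff_surjective _).1 inferInstance
  exact h.comp (cycles₁IsoOfIsTrivial (Rep.trivial K N K)).symm.toLinearEquiv.surjective

theorem chainsToH1_single (x : N) (a : K) :
    chainsToH1 K (Finsupp.single x a) = a • elementClass K x := by
  have : Finsupp.single x a = a • Finsupp.single x (1 : K) := by simp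
  rw [this, map_smul]
  rfl

theorem chainsToH1_eq_zero_iff (x : N →₀ K) :
    chainsToH1 K x = 0 ↔ x ∈ boundaries₁ (Rep.trivial K N K) :=
  H1π_eq_zero_iff (A := Rep.trivial K N K) _

theorem elementClass_mul (x y : N) :
    elementClass K (x * y) = elementClass K x + elementClass K y := by
  have h : chainsToH1 K (Finsupp.single y (1 : K) - Finsupp.single (x * y) 1
      + Finsupp.single x 1) = 0 := by
    rw [chainsToH1_eq_zero_iff]
    refine ⟨Finsupp.single (x, y) (1 : K), ?_⟩
    exact d₂₁_single (A := Rep.trivial K N K) (x, y) (1 : K)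
  rw [map_add, map_sub, chainsToH1_single, chainsToH1_single, chainsToH1_single, one_smul,
    one_smul, one_smul] at h
  rw [← sub_eq_zero, ← neg_eq_zero, ← h]
  abel

theorem span_range_elementClass :
    Submodule.span K (Set.range (elementClass (N := N) K)) = ⊤ := by
  rw [eq_top_iff]
  rintro x -
  obtain ⟨c, rfl⟩ := chainsToH1_surjective K x
  induction c using Finsupp.induction_linear with
  | zero => simp
  | add f g hf hg => rw [map_add]; exact add_mem hf hg
  | single x a =>
    rw [chainsToH1_single]
    exact Submodule.smul_mem _ _ (Submodule.subset_span ⟨x, rfl⟩)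

theorem mapIso_elementClass (e : N ≃* N) (x : N) :
    (mapIso (A := Rep.trivial K N K) (B := Rep.trivial K N K) e (LinearEquiv.refl K K)
      (fun _ => rfl) 1).toLinearEquiv (elementClass K x) = elementClass K (e x) := by
  have h := CategoryTheory.ConcreteCategory.congr_hom (H1π_comp_map (A := Rep.trivial K N K)
    (B := Rep.trivial K N K) (e : N →* N) (Rep.ofHom ⟨LinearMap.id, fun _ => rfl⟩))
    ((cycles₁IsoOfIsTrivial (Rep.trivial K N K)).inv (Finsupp.single x 1))
  refine h.trans ?_
  refine congrArg (H1π (Rep.trivial K N K)) (Subtype.ext ?_)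
  refine (coe_mapCycles₁ (A := Rep.trivial K N K) (B := Rep.trivial K N K) (e : N →* N)
    (Rep.ofHom ⟨LinearMap.id, fun _ => rfl⟩) _).trans ?_
  change Finsupp.mapRange id rfl (Finsupp.mapDomain e (Finsupp.single x (1 : K))) =
    Finsupp.single (e x) (1 : K)
  rw [Finsupp.mapDomain_single, Finsupp.mapRange_single]
  rfl

variable {W : Type*} [AddCommGroup W] [Module K W]

/-- The linear extension of `φ` to chains kills each boundary `y - xy + x`, and for trivial
coefficients every 1-chain is a cycle. This is the source of linear forms on the homology. -/
theorem exists_linearMap_elementClass (φ : N → W) (hφ : ∀ x y, φ (x * y) = φ x + φ y) :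
    ∃ L : groupHomology (Rep.trivial K N K) 1 →ₗ[K] W, ∀ x, L (elementClass K x) = φ x := by
  let Φ : (N →₀ K) →ₗ[K] W := Finsupp.lsum K fun x => LinearMap.toSpanSingleton K W (φ x)
  have hΦ : LinearMap.ker (chainsToH1 (N := N) K) ≤ LinearMap.ker Φ := by
    intro c hc
    rw [LinearMap.mem_ker, chainsToH1_eq_zero_iff] at hc
    obtain ⟨b, rfl⟩ := hc
    rw [LinearMap.mem_ker]
    change (Φ ∘ₗ (d₂₁ (Rep.trivial K N K)).hom) b = 0
    induction b using Finsupp.induction_linear with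
    | zero => exact map_zero _
    | add f g hf hg => rw [map_add, hf, hg, add_zero]
    | single x a =>
      have := d₂₁_single (A := Rep.trivial K N K) x a
      rw [LinearMap.comp_apply]
      erw [this]
      change Φ (Finsupp.single x.2 a - Finsupp.single (x.1 * x.2) a + Finsupp.single x.1 a) = 0
      simp only [map_add, map_sub, Φ, Finsupp.lsum_single, LinearMap.toSpanSingleton_apply, hφ,
        smul_add]
      abel
  refine ⟨(LinearMap.ker (chainsToH1 (N := N) K)).liftQ Φ hΦ ∘ₗ
    (LinearMap.quotKerEquivOfSurjective _ (chainsToH1_surjective (N := N) K)).symm, fun x => ?_⟩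
  have h1 : elementClass K x = LinearMap.quotKerEquivOfSurjective _
      (chainsToH1_surjective (N := N) K) (Submodule.Quotient.mk (Finsupp.single x 1)) := by
    rw [LinearMap.quotKerEquivOfSurjective_apply_mk, chainsToH1_single, one_smul]
  rw [h1]
  simp [Φ]

end groupHomology

/-! ### The homology of the kernel of a character -/

namespace KernelHomology

open LaurentPolynomial groupHomology

variable {G : Type u} [Group G] {χ : G →* Multiplicative ℤ} {g : G}

theorem apply_ne_one (hχ : χ ≠ 1) (hg : Subgroup.zpowers (χ g) = χ.range) : χ g ≠ 1 := by
  intro h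
  rw [h, Subgroup.zpowers_one_eq_bot] at hg
  exact hχ (MonoidHom.range_eq_bot_iff.1 hg.symm)

theorem eq_zero_of_zpow_eq_one {x : Multiplicative ℤ} (hx : x ≠ 1) {n : ℤ} (h : x ^ n = 1) :
    n = 0 := by
  have h' : n * x.toAdd = 0 := by simpa using congrArg Multiplicative.toAdd h
  exact (mul_eq_zero.1 h').resolve_right hx

/-- The character obtained from `χ` on dividing by a generator of its image. -/
theorem exists_exponent (hχ : χ ≠ 1) (hg : Subgroup.zpowers (χ g) = χ.range) :
    ∃ e : G →* Multiplicative ℤ, (∀ x, χ x = χ g ^ (e x).toAdd) ∧ e g = Multiplicative.ofAdd 1 := by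
  have h1 := apply_ne_one hχ hg
  have h : ∀ x, ∃ n : ℤ, χ g ^ n = χ x := fun x =>
    Subgroup.mem_zpowers_iff.1 (hg ▸ ⟨x, rfl⟩ : χ x ∈ Subgroup.zpowers (χ g))
  choose e he using h
  have inj : ∀ m n : ℤ, χ g ^ m = χ g ^ n → m = n := fun m n hmn =>
    sub_eq_zero.1 (eq_zero_of_zpow_eq_one h1 (by rw [zpow_sub, hmn, mul_inv_cancel]))
  refine ⟨MonoidHom.mk' (fun x => Multiplicative.ofAdd (e x)) fun x y => ?_,
    fun x => (he x).symm, ?_⟩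
  · rw [← ofAdd_add]
    exact congrArg _ (inj _ _ (by rw [he, map_mul, zpow_add, he, he]))
  · exact congrArg Multiplicative.ofAdd (inj _ _ (by rw [he, zpow_one]))

variable (K : Type u) [Field K]

/-- The class of an element of the kernel. -/
def kernelClass (χ : G →* Multiplicative ℤ) (g : G) (x : χ.ker) : KernelHomology χ K g 1 :=
  elementClass K x

theorem kernelClass_mul (x y : χ.ker) :
    kernelClass K χ g (x * y) = kernelClass K χ g x + kernelClass K χ g y :=
  elementClass_mul K x y

theorem kernelClass_one : kernelClass K χ g 1 = 0 := by
  have := kernelClass_mul K (g := g) (1 : χ.ker) 1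
  rwa [one_mul, left_eq_add] at this

theorem kernelClass_inv (x : χ.ker) : kernelClass K χ g x⁻¹ = -kernelClass K χ g x := by
  rw [eq_neg_iff_add_eq_zero, ← kernelClass_mul, inv_mul_cancel, kernelClass_one]

theorem T_one_smul_kernelClass (x : χ.ker) :
    (T 1 : LaurentPolynomial K) • kernelClass K χ g x =
      kernelClass K χ g (MulAut.conjNormal g x) :=
  (LaurentModule.T_smul _ _).trans (mapIso_elementClass K (MulAut.conjNormal g) x)

theorem T_smul_kernelClass (n : ℤ) (x : χ.ker) :
    (T n : LaurentPolynomial K) • kernelClass K χ g x =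
      kernelClass K χ g (MulAut.conjNormal (g ^ n) x) := by
  induction n generalizing x with
  | zero => simp
  | succ n ih => rw [T_add, mul_smul, T_one_smul_kernelClass, ih, zpow_add, map_mul, zpow_one]; rfl
  | pred n ih =>
    have h : x = MulAut.conjNormal g (MulAut.conjNormal g⁻¹ x) := by
      rw [← MulAut.mul_apply, ← map_mul, mul_inv_cancel, map_one, MulAut.one_apply]
    conv_lhs => rw [h, ← T_one_smul_kernelClass, smul_smul, ← T_add, sub_add_cancel, ih]
    rw [← MulAut.mul_apply, ← map_mul, zpow_sub, zpow_one]

/-- Classes are additive in a commutative group, so inner automorphisms act trivially; conjugation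
by any group element therefore acts as a power of `t`. -/
theorem conj_kernelClass (y : χ.ker) (x : χ.ker) :
    kernelClass K χ g (MulAut.conjNormal (y : G) x) = kernelClass K χ g x := by
  have : MulAut.conjNormal (y : G) x = y * x * y⁻¹ := Subtype.ext (by simp)
  rw [this, kernelClass_mul, kernelClass_mul, kernelClass_inv]
  abel

theorem eq_top_of_forall_kernelClass_mem
    (P : Submodule (LaurentPolynomial K) (KernelHomology χ K g 1))
    (h : ∀ x, kernelClass K χ g x ∈ P) : P = ⊤ := by
  rw [eq_top_iff]
  rintro x -
  have hx : x ∈ Submodule.span K (Set.range (elementClass (N := χ.ker) K)) := by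
    rw [span_range_elementClass]; trivial
  induction hx using Submodule.span_induction with
  | mem x hx => obtain ⟨y, rfl⟩ := hx; exact h y
  | zero => exact P.zero_mem
  | add x y _ _ hx hy => exact P.add_mem hx hy
  | smul a x _ hx =>
    have h := P.smul_mem (C a) hx
    rw [LaurentModule.C_smul] at h
    exact h

/-- If `G` is finitely generated, so is the first homology of the kernel of a character, as a
module over the Laurent polynomials. -/
theorem finite [Group.FG G] (hχ : χ ≠ 1) (hg : Subgroup.zpowers (χ g) = χ.range) :
    Module.Finite (LaurentPolynomial K) (KernelHomology χ K g 1) := by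
  obtain ⟨S, hS⟩ := Group.fg_def.1 (inferInstance : Group.FG G)
  obtain ⟨e, he, heg⟩ := exists_exponent hχ hg
  have hn : ∀ x : G, x * g ^ (-(e x).toAdd) ∈ χ.ker := fun x => by
    rw [MonoidHom.mem_ker, map_mul, map_zpow, he x, zpow_neg, mul_inv_cancel]
  let P := Submodule.span (LaurentPolynomial K)
    ((fun s : G => kernelClass K χ g ⟨_, hn s⟩) '' (S : Set G))
  refine ⟨Submodule.fg_def.2 ⟨_, S.finite_toSet.image fun s : G => kernelClass K χ g ⟨_, hn s⟩, ?_⟩⟩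
  refine eq_top_of_forall_kernelClass_mem K P ?_
  -- `Q` is normal in `G` because conjugation acts on classes by powers of `t`. With `g` it
  -- generates `G`, so a kernel element is `q * g ^ k`, and applying `χ` forces `k = 0`.
  let Q : Subgroup G :=
    { carrier := {x | ∃ h : x ∈ χ.ker, kernelClass K χ g ⟨x, h⟩ ∈ P}
      one_mem' := ⟨one_mem _, by
        have : kernelClass K χ g ⟨1, one_mem _⟩ = 0 := kernelClass_one K
        rw [this]; exact P.zero_mem⟩
      mul_mem' := by
        rintro x y ⟨hx, hx'⟩ ⟨hy, hy'⟩
        exact ⟨mul_mem hx hy, (kernelClass_mul K ⟨x, hx⟩ ⟨y, hy⟩) ▸ P.add_mem hx' hy'⟩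
      inv_mem' := by
        rintro x ⟨hx, hx'⟩
        exact ⟨inv_mem hx, (kernelClass_inv K ⟨x, hx⟩) ▸ P.neg_mem hx'⟩ }
  have hQ : Q.Normal := ⟨by
    rintro x ⟨hx, hx'⟩ y
    refine ⟨χ.normal_ker.conj_mem x hx y, ?_⟩
    have hy : (⟨y * x * y⁻¹, χ.normal_ker.conj_mem x hx y⟩ : χ.ker) =
        MulAut.conjNormal (((⟨_, hn y⟩ : χ.ker) : G)) (MulAut.conjNormal (g ^ (e y).toAdd)
          ⟨x, hx⟩) := Subtype.ext (by simp [mul_assoc])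
    rw [hy, conj_kernelClass, ← T_smul_kernelClass]
    exact P.smul_mem _ hx'⟩
  have htop : Q ⊔ Subgroup.zpowers g = ⊤ := by
    rw [eq_top_iff, ← hS, Subgroup.closure_le]
    intro s hs
    have hs' : s = (s * g ^ (-(e s).toAdd)) * g ^ (e s).toAdd := by group
    rw [hs']
    refine mul_mem (Subgroup.mem_sup_left ⟨hn s, ?_⟩)
      (Subgroup.mem_sup_right (Subgroup.zpow_mem_zpowers _ _))
    exact Submodule.subset_span ⟨s, hs, rfl⟩
  rintro ⟨x, hx⟩
  have hx' : x ∈ ((Q ⊔ Subgroup.zpowers g : Subgroup G) : Set G) := htop ▸ Set.mem_univ x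
  rw [Subgroup.normal_mul] at hx'
  obtain ⟨q, ⟨hq, hq'⟩, _, ⟨k, rfl⟩, rfl⟩ := hx'
  have hk : k = 0 := by
    rw [MonoidHom.mem_ker, map_mul, MonoidHom.mem_ker.1 hq, one_mul, map_zpow] at hx
    exact eq_zero_of_zpow_eq_one (apply_ne_one hχ hg) hx
  subst hk
  simpa using hq'

/-! ### Crossed homomorphisms -/

/-- The crossed homomorphisms from `G` to the field `F` on which `G` acts by `τ`. -/
def crossedHoms {G F : Type*} [Group G] [Field F] (τ : G →* Fˣ) : Submodule F (G → F) where
  carrier := {D | ∀ x y, D (x * y) = D x + τ x * D y}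
  add_mem' {D D'} h h' x y := by simp only [Pi.add_apply, h x y, h' x y]; ring
  zero_mem' x y := by simp
  smul_mem' a D h x y := by simp only [Pi.smul_apply, smul_eq_mul, h x y]; ring

theorem crossedHoms_apply_one {G F : Type*} [Group G] [Field F] {τ : G →* Fˣ} {D : G → F}
    (hD : D ∈ crossedHoms τ) : D 1 = 0 := by
  have := hD 1 1
  simpa using this

theorem crossedHoms_apply_zpow {G F : Type*} [Group G] [Field F] {τ : G →* Fˣ} {D : G → F}
    (hD : D ∈ crossedHoms τ) {x : G} (hx : D x = 0) (n : ℤ) : D (x ^ n) = 0 := by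
  induction n with
  | zero => simpa using crossedHoms_apply_one hD
  | succ n ih => rw [zpow_add, zpow_one, hD, ih, hx]; simp
  | pred n ih =>
    have := hD (x ^ (-(n : ℤ) - 1)) x
    rw [← zpow_add_one, sub_add_cancel, ih, hx, mul_zero, add_zero] at this
    exact this.symm

theorem map_smul_of_map_T_smul {K M F : Type u} [Field K] [AddCommGroup M] [Module K M]
    (φ : M ≃ₗ[K] M) [AddCommGroup F] [Module K F] [Module (LaurentPolynomial K) F]
    [IsScalarTower K (LaurentPolynomial K) F] (L : M →ₗ[K] F)
    (hL : ∀ m, L (φ m) = (T 1 : LaurentPolynomial K) • L m)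
    (p : LaurentPolynomial K) (m : LaurentModule φ) :
    L (p • m : LaurentModule φ) = p • L m := by
  have hT : ∀ (n : ℤ) (m : LaurentModule φ),
      L ((T n : LaurentPolynomial K) • m : LaurentModule φ) = (T n : LaurentPolynomial K) • L m := by
    have h1 : ∀ m : LaurentModule φ, L ((T 1 : LaurentPolynomial K) • m : LaurentModule φ) =
        (T 1 : LaurentPolynomial K) • L m := fun m => by
      rw [LaurentModule.T_smul]; exact hL m
    intro n
    induction n with
    | zero => simp
    | succ n ih => intro m; rw [T_add, mul_smul, ih, h1, smul_smul]
    | pred n ih =>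
      intro m
      have h2 : m = (T 1 : LaurentPolynomial K) • (T (-1) : LaurentPolynomial K) • m := by
        rw [smul_smul, ← T_add]; simp
      rw [T_sub, mul_smul, ih]
      conv_rhs => rw [h2]
      rw [h1, smul_smul, mul_assoc, ← T_add]
      simp
  induction p using LaurentPolynomial.induction_on' with
  | add p q hp hq => rw [add_smul, add_smul, ← hp, ← hq]; exact map_add L _ _
  | C_mul_T n a =>
    rw [mul_smul, mul_smul, ← hT, LaurentModule.C_smul, C_eq_algebraMap, algebraMap_smul]
    exact map_smul L a _

/-- The action on `F` through the character `e`, a generator acting by `u`. -/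
def unitCharacter {G F : Type*} [Group G] [Field F] (u : Fˣ) (e : G →* Multiplicative ℤ) :
    G →* Fˣ :=
  (zpowersHom Fˣ u).comp e

theorem unitCharacter_apply {G F : Type*} [Group G] [Field F] (u : Fˣ)
    (e : G →* Multiplicative ℤ) (x : G) : unitCharacter u e x = u ^ (e x).toAdd := rfl

theorem algebraMap_T {K F : Type*} [Field K] [Field F] [Algebra (LaurentPolynomial K) F] {u : Fˣ}
    (hu : (u : F) = algebraMap (LaurentPolynomial K) F (T 1)) (n : ℤ) :
    algebraMap (LaurentPolynomial K) F (T n) = ((u ^ n : Fˣ) : F) := by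
  induction n with
  | zero => simp
  | succ n ih => rw [T_add, map_mul, ih, ← hu, zpow_add, zpow_one, Units.val_mul]
  | pred n ih =>
    rw [← mul_left_inj' u.ne_zero, ← Units.val_mul, ← zpow_add_one, sub_add_cancel, ← ih, hu,
      ← map_mul, ← T_add, sub_add_cancel]

/-- Up to principal crossed homomorphisms, the crossed homomorphisms of `G` are the linear forms on
the first homology of the kernel of a character. -/
theorem finrank_crossedHoms {F : Type u} [Field F] [Algebra (LaurentPolynomial K) F] [Algebra K F]
    [IsScalarTower K (LaurentPolynomial K) F]
    (hχ : χ ≠ 1) (hg : Subgroup.zpowers (χ g) = χ.range) {e : G →* Multiplicative ℤ}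
    (he : ∀ x, χ x = χ g ^ (e x).toAdd) (heg : e g = Multiplicative.ofAdd 1)
    {u : Fˣ} (hu : (u : F) = algebraMap (LaurentPolynomial K) F (T 1)) (hu1 : (u : F) ≠ 1)
    [Module.Finite F (KernelHomology χ K g 1 →ₗ[LaurentPolynomial K] F)] :
    Module.finrank F (crossedHoms (unitCharacter u e)) =
      Module.finrank F (KernelHomology χ K g 1 →ₗ[LaurentPolynomial K] F) + 1 := by
  set τ := unitCharacter u e with hτ
  have hker : ∀ x ∈ χ.ker, (e x).toAdd = 0 := fun x hx =>
    eq_zero_of_zpow_eq_one (apply_ne_one hχ hg) ((he x).symm.trans hx)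
  have hn : ∀ x : G, x * g ^ (-(e x).toAdd) ∈ χ.ker := fun x => by
    rw [MonoidHom.mem_ker, map_mul, map_zpow, he x, zpow_neg, mul_inv_cancel]
  have hτker : ∀ x ∈ χ.ker, τ x = 1 := fun x hx => by
    rw [hτ, unitCharacter_apply, hker x hx, zpow_zero]
  have hτg : τ g = u := by rw [hτ, unitCharacter_apply, heg]; simp
  have hTu : ∀ (n : ℤ) (y : F), (T n : LaurentPolynomial K) • y = ((u ^ n : Fˣ) : F) * y := by
    intro n y
    rw [Algebra.smul_def, algebraMap_T hu]
  -- The form is extended off the kernel by the retraction `x ↦ x * g ^ (-e x)`; the summand `c * (τ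
  -- x - 1)` is the principal part.
  have hD : ∀ (L : KernelHomology χ K g 1 →ₗ[LaurentPolynomial K] F) (c : F),
      (fun x => L (kernelClass K χ g ⟨_, hn x⟩) + c * (τ x - 1)) ∈ crossedHoms τ := by
    intro L c x y
    have hxy : (⟨_, hn (x * y)⟩ : χ.ker) =
        ⟨_, hn x⟩ * MulAut.conjNormal (g ^ (e x).toAdd) ⟨_, hn y⟩ := Subtype.ext (by
      simp only [map_mul, toAdd_mul, Subgroup.coe_mul, MulAut.conjNormal_apply]
      group)
    simp only
    rw [hxy, kernelClass_mul, ← T_smul_kernelClass, map_add, map_smul, hTu, ← unitCharacter_apply,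
      ← hτ, map_mul, Units.val_mul]
    ring
  let R : ((KernelHomology χ K g 1 →ₗ[LaurentPolynomial K] F) × F) →ₗ[F] crossedHoms τ :=
    { toFun p := ⟨_, hD p.1 p.2⟩
      map_add' p q := Subtype.ext (funext fun x => by
        simp only [Prod.fst_add, Prod.snd_add, LinearMap.add_apply, Submodule.coe_add,
          Pi.add_apply]
        ring)
      map_smul' a p := Subtype.ext (funext fun x => by
        simp only [Prod.smul_fst, Prod.smul_snd, LinearMap.smul_apply, Submodule.coe_smul,
          Pi.smul_apply, smul_eq_mul, RingHom.id_apply]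
        ring) }
  have hR : ∀ p x, (R p : G → F) x =
      p.1 (kernelClass K χ g ⟨_, hn x⟩) + p.2 * (τ x - 1) := fun _ _ => rfl
  have hng : (⟨_, hn g⟩ : χ.ker) = 1 := Subtype.ext (by simp [heg])
  have hnk : ∀ x : χ.ker, (⟨_, hn x⟩ : χ.ker) = x := fun x =>
    Subtype.ext (by simp [hker x x.2])
  have hu1' : (u : F) - 1 ≠ 0 := sub_ne_zero.2 hu1
  have hinj : Function.Injective R := by
    rw [← LinearMap.ker_eq_bot, LinearMap.ker_eq_bot']
    rintro ⟨L, c⟩ h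
    have h' : ∀ x, L (kernelClass K χ g ⟨_, hn x⟩) + c * (τ x - 1) = 0 := fun x =>
      (hR (L, c) x).symm.trans (by rw [h]; rfl)
    have hc : c = 0 := by
      have := h' g
      rw [hng, kernelClass_one, map_zero, zero_add, hτg] at this
      exact (mul_eq_zero.1 this).resolve_right hu1'
    have hL : LinearMap.ker L = ⊤ := eq_top_of_forall_kernelClass_mem K _ fun x => by
      have := h' x
      rwa [hnk, hc, zero_mul, add_zero] at this
    rw [hc, LinearMap.ker_eq_top.1 hL]
    rfl
  have hsurj : Function.Surjective R := by
    rintro ⟨D, hDmem⟩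
    -- This principal part makes `D'` vanish at `g`, so `D'` is determined by its restriction to the
    -- kernel, which is additive and turns conjugation by `g` into multiplication by `u`.
    let c := D g / ((u : F) - 1)
    let D' : G → F := fun x => D x - c * (τ x - 1)
    have hD' : D' ∈ crossedHoms τ := by
      intro x y
      simp only [D', hDmem x y, map_mul, Units.val_mul]
      ring
    have hD'g : D' g = 0 := by
      simp only [D', c, hτg]
      field_simp
      ring
    obtain ⟨L, hL⟩ := exists_linearMap_elementClass (N := χ.ker) K (fun x => D' x) (by
      intro x y
      rw [Subgroup.coe_mul, hD' x y, hτker x x.2, Units.val_one, one_mul])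
    have hLT : ∀ m, L (conjHomologyEquiv χ.ker K g 1 m) = (T 1 : LaurentPolynomial K) • L m := by
      intro m
      have hm : m ∈ Submodule.span K (Set.range (elementClass (N := χ.ker) K)) := by
        rw [span_range_elementClass]; trivial
      induction hm using Submodule.span_induction with
      | mem m hm =>
        obtain ⟨x, rfl⟩ := hm
        have h1 : conjHomologyEquiv χ.ker K g 1 (elementClass K x) =
            elementClass K (MulAut.conjNormal g x) := mapIso_elementClass K _ x
        have h2 := hD' (g * x * g⁻¹) g
        rw [inv_mul_cancel_right, hD' g x, hD'g, hτg, mul_zero, zero_add, add_zero] at h2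
        rw [h1, hL, hL, hTu, zpow_one, MulAut.conjNormal_apply, h2]
      | zero => simp
      | add x y _ _ hx hy => simp only [map_add, hx, hy, smul_add]
      | smul a x _ hx => rw [map_smul, map_smul, map_smul, hx, smul_comm]
    refine ⟨(⟨⟨L, map_add L⟩, map_smul_of_map_T_smul _ L hLT⟩, c), Subtype.ext (funext fun x => ?_)⟩
    rw [hR]
    have h1 : D' x = D' (x * g ^ (-(e x).toAdd)) := by
      rw [hD' x, crossedHoms_apply_zpow hD' hD'g, mul_zero, add_zero]
    have h2 : L (elementClass K ⟨_, hn x⟩) = D' x := (hL _).trans h1.symm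
    change L (elementClass K ⟨_, hn x⟩) + c * (τ x - 1) = D x
    rw [h2]
    simp [D']
  rw [← (LinearEquiv.ofBijective R ⟨hinj, hsurj⟩).finrank_eq, Module.finrank_prod,
    Module.finrank_self]

end KernelHomology

/-! ### Crossed homomorphisms of presented groups -/

/-- The permutation `z ↦ b + a z` of a field. -/
def affinePerm {F : Type*} [Field F] (a : Fˣ) (b : F) : Equiv.Perm F :=
  (Units.mulLeft a).trans (Equiv.addLeft b)

namespace affinePerm

variable {F : Type*} [Field F]

theorem apply (a : Fˣ) (b z : F) : affinePerm a b z = b + a * z := rfl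

theorem apply_zero (a : Fˣ) (b : F) : affinePerm a b 0 = b := by simp [apply]

theorem mul (a a' : Fˣ) (b b' : F) :
    affinePerm a b * affinePerm a' b' = affinePerm (a * a') (b + a * b') := by
  ext z
  simp only [Equiv.Perm.mul_apply, apply, Units.val_mul]
  ring

theorem one : affinePerm (1 : Fˣ) 0 = 1 := by
  ext z
  simp [apply]

theorem inv (a : Fˣ) (b : F) : (affinePerm a b)⁻¹ = affinePerm a⁻¹ (-((a⁻¹ : Fˣ) * b)) := by
  rw [inv_eq_iff_mul_eq_one, mul, ← one]
  simp

theorem pow (a : Fˣ) (b : F) (k : ℕ) :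
    affinePerm a b ^ k = affinePerm (a ^ k) ((∑ i ∈ Finset.range k, (a : F) ^ i) * b) := by
  induction k with
  | zero => simp [one]
  | succ k ih =>
    rw [pow_succ, ih, mul, Finset.sum_range_succ, pow_succ, Units.val_pow_eq_pow_val]
    ring_nf

theorem eq_iff (a : Fˣ) (b b' : F) : affinePerm a b = affinePerm a b' ↔ b = b' :=
  ⟨fun h => by rw [← apply_zero a b, h, apply_zero], fun h => h ▸ rfl⟩

/-- Both sides have multiplier `(a a')^k`; their translation parts are the same geometric sum times
`b + a b'` and `b' + a' b` respectively. -/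
theorem mul_pow_eq_mul_pow_iff (a a' : Fˣ) (b b' : F) (k : ℕ) :
    (affinePerm a b * affinePerm a' b') ^ k = (affinePerm a' b' * affinePerm a b) ^ k ↔
      (∑ i ∈ Finset.range k, ((a * a' : Fˣ) : F) ^ i) = 0 ∨ (1 - a') * b = (1 - a) * b' := by
  rw [mul, mul, pow, pow, mul_comm a' a, eq_iff, mul_eq_mul_left_iff, or_comm]
  refine or_congr_right ?_
  constructor <;> intro h <;> linear_combination h

end affinePerm

namespace LabeledGraph

open KernelHomology

variable {V : Type u} (Γ : LabeledGraph V)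

theorem lift_alternatingWord {H : Type*} [Group H] (f : V → H) (v w : V) {n : ℕ} (hn : Even n) :
    FreeGroup.lift f (alternatingWord v w n) = (f v * f w) ^ (n / 2) := by
  simp [alternatingWord, hn]

theorem gen_mul_gen_pow (hΓ : Γ.IsEven) {v w : V} (h : Γ.graph.Adj v w) :
    (Γ.gen v * Γ.gen w) ^ (Γ.label ⟨s(v, w), h⟩ / 2) =
      (Γ.gen w * Γ.gen v) ^ (Γ.label ⟨s(v, w), h⟩ / 2) := by
  have h1 : PresentedGroup.mk Γ.artinRelators (alternatingWord v w (Γ.label ⟨s(v, w), h⟩) *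
      (alternatingWord w v (Γ.label ⟨s(v, w), h⟩))⁻¹) = 1 :=
    PresentedGroup.one_of_mem ⟨v, w, h, rfl⟩
  rw [map_mul, map_inv, mul_inv_eq_one] at h1
  simp only [alternatingWord, hΓ ⟨s(v, w), h⟩, if_true, mul_one, map_pow,
    map_mul] at h1
  exact h1

theorem closure_range_gen : Subgroup.closure (Set.range Γ.gen) = ⊤ :=
  PresentedGroup.closure_range_of _

instance [Finite V] : Group.FG Γ.ArtinGroup :=
  Group.fg_iff.2 ⟨_, Γ.closure_range_gen, Set.finite_range _⟩

variable {F : Type u} [Field F] (τ : Γ.ArtinGroup →* Fˣ)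

/-- The values of a crossed homomorphism on the standard generators. -/
def crossedHomValues : crossedHoms τ →ₗ[F] (V → F) :=
  LinearMap.funLeft F F Γ.gen ∘ₗ (crossedHoms τ).subtype

/-- A crossed homomorphism, as an action by affine permutations. -/
def affineAction {G : Type*} [Group G] {τ : G →* Fˣ} (D : crossedHoms τ) : G →* Equiv.Perm F :=
  MonoidHom.mk' (fun x => affinePerm (τ x) (D.1 x)) fun x y => by
    rw [affinePerm.mul, ← map_mul, D.2 x y]

theorem crossedHomValues_injective : Function.Injective (Γ.crossedHomValues τ) := by
  intro D D' h
  have h1 : affineAction D = affineAction D' := PresentedGroup.ext fun v =>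
    congrArg (affinePerm (τ (Γ.gen v))) (congrFun h v)
  exact Subtype.ext (funext fun x =>
    (affinePerm.eq_iff (τ x) (D.1 x) (D'.1 x)).1 (DFunLike.congr_fun h1 x))

theorem mem_range_crossedHomValues_iff (hΓ : Γ.IsEven) (x : V → F) :
    x ∈ LinearMap.range (Γ.crossedHomValues τ) ↔ ∀ v w (h : Γ.graph.Adj v w),
      (∑ i ∈ Finset.range (Γ.label ⟨s(v, w), h⟩ / 2),
        ((τ (Γ.gen v) * τ (Γ.gen w) : Fˣ) : F) ^ i) = 0 ∨
      (1 - τ (Γ.gen w)) * x v = (1 - τ (Γ.gen v)) * x w := by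
  simp_rw [← affinePerm.mul_pow_eq_mul_pow_iff]
  constructor
  · rintro ⟨D, rfl⟩ v w h
    have h1 := congrArg (affineAction D) (Γ.gen_mul_gen_pow hΓ h)
    rw [map_pow, map_pow, map_mul, map_mul] at h1
    exact h1
  · intro hx
    let f : V → Equiv.Perm F := fun v => affinePerm (τ (Γ.gen v)) (x v)
    let ρ : Γ.ArtinGroup →* Equiv.Perm F := PresentedGroup.toGroup (f := f) (by
      rintro _ ⟨v, w, h, rfl⟩
      rw [map_mul, map_inv, lift_alternatingWord f v w (hΓ _),
        lift_alternatingWord f w v (hΓ _), mul_inv_eq_one]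
      exact hx v w h)
    have hρgen : ∀ v, ρ (Γ.gen v) = f v := fun v => PresentedGroup.toGroup.of _
    -- The lift takes values in all permutations of `F`; that it stays affine with multiplier `τ` is
    -- checked on generators, and its translation part is the crossed homomorphism.
    have hρ : ∀ y, ∃ b, ρ y = affinePerm (τ y) b := by
      intro y
      have hy : y ∈ Subgroup.closure (Set.range Γ.gen) := by
        rw [closure_range_gen]; trivial
      induction hy using Subgroup.closure_induction with
      | mem y hy => obtain ⟨v, rfl⟩ := hy; exact ⟨x v, hρgen v⟩
      | one => exact ⟨0, by rw [map_one, map_one, affinePerm.one]⟩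
      | mul y z _ _ hy hz =>
        obtain ⟨b, hb⟩ := hy
        obtain ⟨c, hc⟩ := hz
        exact ⟨_, by rw [map_mul, map_mul, hb, hc, affinePerm.mul]⟩
      | inv y _ hy =>
        obtain ⟨b, hb⟩ := hy
        exact ⟨_, by rw [map_inv, map_inv, hb, affinePerm.inv]⟩
    choose D hD using hρ
    refine ⟨⟨D, fun y z => ?_⟩, funext fun v => ?_⟩
    · rw [← affinePerm.eq_iff (τ (y * z)), ← hD, map_mul, map_mul, hD, hD, affinePerm.mul]
    · exact (affinePerm.eq_iff (τ (Γ.gen v)) _ _).1 ((hD _).symm.trans (hρgen v))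

end LabeledGraph

/-! ### Components of a graph -/

/-- For `n ≠ 0` a vanishing sum would give `u ^ (n k) = 1`; for `n = 0` the sum is `k`. This is
where the characteristic enters. -/
theorem Units.geom_sum_zpow_eq_zero_iff {F : Type*} [Field F] {u : Fˣ}
    (hu : ∀ n : ℤ, u ^ n = 1 → n = 0) (n : ℤ) {k : ℕ} (hk : k ≠ 0) :
    (∑ i ∈ Finset.range k, ((u ^ n : Fˣ) : F) ^ i) = 0 ↔ n = 0 ∧ (k : F) = 0 := by
  by_cases hn : n = 0
  · simp [hn]
  · refine iff_of_false (fun h => ?_) fun h => hn h.1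
    have h1 := geom_sum_mul ((u ^ n : Fˣ) : F) k
    rw [h, zero_mul, eq_comm, sub_eq_zero, ← Units.val_pow_eq_pow_val, Units.val_eq_one,
      ← zpow_natCast, ← zpow_mul] at h1
    have := hu _ h1
    simp [hn, hk] at this

theorem finrank_homologyAt_add_finrank_range {K A B C : Type u} [Field K] [AddCommGroup A]
    [AddCommGroup B] [AddCommGroup C] [Module K A] [Module K B] [Module K C] [Module.Finite K B]
    {f : A →ₗ[K] B} {g : B →ₗ[K] C} (h : LinearMap.range f ≤ LinearMap.ker g) :
    Module.finrank K (HomologyAt f g) + Module.finrank K (LinearMap.range f) =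
      Module.finrank K (LinearMap.ker g) := by
  rw [← (Submodule.submoduleOfEquivOfLe h).finrank_eq, Submodule.finrank_quotient_add_finrank]

namespace SimpleGraph

variable {W : Type u} (G : SimpleGraph W) (K : Type u) [Field K]

theorem connected_iff_card_connectedComponent :
    G.Connected ↔ Nat.card G.ConnectedComponent = 1 := by
  rw [connected_iff, Nat.card_eq_one_iff_unique]
  constructor
  · rintro ⟨h, ⟨v⟩⟩
    exact ⟨h.subsingleton_connectedComponent, ⟨G.connectedComponentMk v⟩⟩
  · rintro ⟨h, ⟨c⟩⟩
    refine ⟨fun v w => ConnectedComponent.exact (h.elim _ _), ?_⟩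
    induction c using ConnectedComponent.ind with | _ v => exact ⟨v⟩

/-- The map induced on `0`-chains by the projection to components. -/
def componentMap : (W →₀ K) →ₗ[K] (G.ConnectedComponent →₀ K) :=
  Finsupp.lmapDomain K K G.connectedComponentMk

theorem boundaryOne_single (d : G.Dart) (a : K) :
    G.boundaryOne K (Finsupp.single d a) = Finsupp.single d.snd a - Finsupp.single d.fst a := by
  simp [boundaryOne]

theorem single_sub_single_mem_range_boundaryOne {v w : W} (h : G.Reachable v w) (a : K) :
    (Finsupp.single w a - Finsupp.single v a : W →₀ K) ∈ LinearMap.range (G.boundaryOne K) := by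
  obtain ⟨p⟩ := h
  induction p with
  | nil => simp
  | @cons v x w hvx _ ih =>
    have := add_mem ih ⟨_, G.boundaryOne_single K ⟨(v, x), hvx⟩ a⟩
    simpa using this

theorem ker_componentMap :
    LinearMap.ker (G.componentMap K) = LinearMap.range (G.boundaryOne K) := by
  apply le_antisymm
  · intro c hc
    -- `S` moves each vertex to a chosen representative of its component, which changes a chain by a
    -- boundary; on the kernel of `componentMap` it is zero.
    let s : G.ConnectedComponent → W := fun x => x.out
    let S : (W →₀ K) →ₗ[K] (W →₀ K) :=
      Finsupp.lmapDomain K K s ∘ₗ G.componentMap K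
    have h : ∀ c, c - S c ∈ LinearMap.range (G.boundaryOne K) := by
      intro c
      induction c using Finsupp.induction_linear with
      | zero => simp
      | add f g hf hg => rw [map_add, add_sub_add_comm]; exact add_mem hf hg
      | single v a =>
        have h1 : S (Finsupp.single v a) = Finsupp.single (s (G.connectedComponentMk v)) a := by
          simp [S, componentMap]
        rw [h1]
        exact G.single_sub_single_mem_range_boundaryOne K
          (ConnectedComponent.exact (Quot.out_eq _)) a
    have := h c
    rwa [LinearMap.comp_apply, LinearMap.mem_ker.1 hc, map_zero, sub_zero] at this
  · rintro _ ⟨b, rfl⟩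
    rw [LinearMap.mem_ker]
    induction b using Finsupp.induction_linear with
    | zero => simp
    | add f g hf hg => rw [map_add, map_add, hf, hg, add_zero]
    | single d a =>
      rw [boundaryOne_single, map_sub, componentMap, Finsupp.lmapDomain_apply,
        Finsupp.lmapDomain_apply, Finsupp.mapDomain_single, Finsupp.mapDomain_single,
        ConnectedComponent.sound d.adj.reachable, sub_self]

theorem componentMap_surjective : Function.Surjective (G.componentMap K) :=
  Finsupp.mapDomain_surjective fun c => c.exists_rep

theorem finrank_reducedHomologyZero_add_one [Finite W] [Nonempty W] :
    Module.finrank K (G.ReducedHomologyZero K) + 1 = Nat.card G.ConnectedComponent := by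
  have : Fintype W := Fintype.ofFinite W
  have : Fintype G.ConnectedComponent := Fintype.ofFinite _
  have hle : LinearMap.range (G.boundaryOne K) ≤ LinearMap.ker (augmentation W K) := by
    rintro _ ⟨b, rfl⟩
    rw [LinearMap.mem_ker]
    induction b using Finsupp.induction_linear with
    | zero => simp
    | add f g hf hg => rw [map_add, map_add, hf, hg, add_zero]
    | single d a =>
      rw [boundaryOne_single, map_sub]
      simp [augmentation]
  have haug : LinearMap.range (augmentation W K) = ⊤ := by
    rw [LinearMap.range_eq_top]
    intro a
    exact ⟨Finsupp.single (Classical.arbitrary W) a, by simp [augmentation]⟩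
  have h1 := (augmentation W K).finrank_range_add_finrank_ker
  have h2 := (G.componentMap K).finrank_range_add_finrank_ker
  rw [LinearMap.range_eq_top.2 (G.componentMap_surjective K), finrank_top, ker_componentMap,
    Module.finrank_finsupp_self] at h2
  rw [haug, finrank_top, Module.finrank_self] at h1
  have h3 := finrank_homologyAt_add_finrank_range hle
  rw [Nat.card_eq_fintype_card]
  change Module.finrank K (HomologyAt (G.boundaryOne K) (augmentation W K)) + 1 = _
  omega

end SimpleGraph

/-! ### Crossed homomorphisms and components of the reduced graph -/

namespace LabeledGraph

open KernelHomology

variable {V K : Type u} [Field K] (Γ : LabeledGraph V) (χ : Γ.ArtinGroup →* Multiplicative ℤ)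
  {F : Type u} [Field F] (τ : Γ.ArtinGroup →* Fˣ)

theorem edgeWeight_mk (v w : V) :
    Γ.edgeWeight χ s(v, w) = Γ.vertexWeight χ v + Γ.vertexWeight χ w := rfl

theorem exists_not_mem_resonantVertices {χ : Γ.ArtinGroup →* Multiplicative ℤ} (hχ : χ ≠ 1) :
    ∃ v, v ∉ Γ.resonantVertices χ := by
  by_contra! h
  exact hχ (PresentedGroup.ext fun v => Multiplicative.toAdd.injective (h v))

theorem nonempty_compl_deletedVertices {χ : Γ.ArtinGroup →* Multiplicative ℤ} (hχ : χ ≠ 1) :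
    Nonempty ((Γ.deletedVertices χ)ᶜ : Set V) :=
  let ⟨v, hv⟩ := Γ.exists_not_mem_resonantVertices hχ
  ⟨⟨v, fun h => hv h.1⟩⟩

open scoped Classical in
/-- The nonzero factor relating the value of a crossed homomorphism on a generator to the
component of its vertex in the reduced graph. -/
def vertexFactor (v : V) : F :=
  if v ∈ Γ.resonantVertices χ then 1 else 1 - τ (Γ.gen v)

variable {χ τ} in
theorem vertexFactor_ne_zero (hτ : ∀ v, τ (Γ.gen v) = 1 ↔ v ∈ Γ.resonantVertices χ) (v : V) :
    Γ.vertexFactor χ τ v ≠ 0 := by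
  unfold vertexFactor
  split_ifs with h
  · exact one_ne_zero
  · rw [sub_ne_zero, ne_comm, Ne, Units.val_eq_one, hτ]
    exact h

variable (K) in
open scoped Classical in
/-- The values on generators determined by a function on the components of the reduced graph. -/
def componentValues : ((Γ.reducedGraph χ K).ConnectedComponent → F) →ₗ[F] (V → F) where
  toFun y v := if h : v ∈ (Γ.deletedVertices χ)ᶜ then
    y ((Γ.reducedGraph χ K).connectedComponentMk ⟨v, h⟩) * Γ.vertexFactor χ τ v else 0
  map_add' y y' := by
    ext v
    simp only [Pi.add_apply]
    split_ifs <;> ring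
  map_smul' a y := by
    ext v
    simp only [Pi.smul_apply, smul_eq_mul, RingHom.id_apply]
    split_ifs <;> ring

theorem componentValues_apply (y : (Γ.reducedGraph χ K).ConnectedComponent → F) {v : V}
    (h : v ∈ (Γ.deletedVertices χ)ᶜ) : Γ.componentValues K χ τ y v =
      y ((Γ.reducedGraph χ K).connectedComponentMk ⟨v, h⟩) * Γ.vertexFactor χ τ v :=
  dif_pos h

theorem componentValues_apply_of_mem (y : (Γ.reducedGraph χ K).ConnectedComponent → F) {v : V}
    (h : v ∈ Γ.deletedVertices χ) : Γ.componentValues K χ τ y v = 0 :=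
  dif_neg fun h' => h' h

variable {χ τ} in
theorem componentValues_injective (hτ : ∀ v, τ (Γ.gen v) = 1 ↔ v ∈ Γ.resonantVertices χ) :
    Function.Injective (Γ.componentValues K χ τ) := by
  rw [← LinearMap.ker_eq_bot, LinearMap.ker_eq_bot']
  intro y hy
  ext c
  induction c using SimpleGraph.ConnectedComponent.ind with | _ v
  have h := congrFun hy v.1
  rw [componentValues_apply _ _ _ _ v.2] at h
  exact (mul_eq_zero.1 h).resolve_right (Γ.vertexFactor_ne_zero hτ v.1)

variable {χ} in
theorem reducedGraph_adj {v w : ((Γ.deletedVertices χ)ᶜ : Set V)} :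
    (Γ.reducedGraph χ K).Adj v w ↔ Γ.graph.Adj v w ∧ s((v : V), (w : V)) ∉ Γ.deletedEdges χ K := by
  simp [reducedGraph, SimpleGraph.deleteEdges_adj]

variable {χ τ} in
theorem mem_range_componentValues_iff (hτ : ∀ v, τ (Γ.gen v) = 1 ↔ v ∈ Γ.resonantVertices χ)
    (x : V → F) : x ∈ LinearMap.range (Γ.componentValues K χ τ) ↔
      ∀ v w, Γ.graph.Adj v w → s(v, w) ∈ Γ.resonantEdges χ K ∨
        (1 - τ (Γ.gen w)) * x v = (1 - τ (Γ.gen v)) * x w := by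
  have h1 : ∀ v, v ∈ Γ.resonantVertices χ → (1 : F) - τ (Γ.gen v) = 0 := fun v hv => by
    rw [(hτ v).2 hv, Units.val_one, sub_self]
  have hdel : ∀ v w, Γ.graph.Adj v w → v ∈ Γ.resonantVertices χ → w ∉ Γ.resonantVertices χ →
      v ∈ Γ.deletedVertices χ := fun v w h hv hw => ⟨hv, w, hw, h⟩
  constructor
  · rintro ⟨y, rfl⟩ v w h
    refine or_iff_not_imp_left.2 fun hres => ?_
    by_cases hv : v ∈ Γ.resonantVertices χ <;> by_cases hw : w ∈ Γ.resonantVertices χ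
    · rw [h1 v hv, h1 w hw, zero_mul, zero_mul]
    · rw [h1 v hv, Γ.componentValues_apply_of_mem _ _ _ (hdel v w h hv hw), zero_mul, mul_zero]
    · rw [h1 w hw, Γ.componentValues_apply_of_mem _ _ _ (hdel w v h.symm hw hv), zero_mul,
        mul_zero]
    · have hv' : v ∈ (Γ.deletedVertices χ)ᶜ := fun h => hv h.1
      have hw' : w ∈ (Γ.deletedVertices χ)ᶜ := fun h => hw h.1
      have hadj : (Γ.reducedGraph χ K).Adj ⟨v, hv'⟩ ⟨w, hw'⟩ :=
        Γ.reducedGraph_adj.2 ⟨h, fun h' => h'.elim hres fun h'' => hv (h'' v (by simp))⟩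
      rw [componentValues_apply _ _ _ _ hv', componentValues_apply _ _ _ _ hw',
        SimpleGraph.ConnectedComponent.connectedComponentMk_eq_of_adj hadj, vertexFactor,
        vertexFactor, if_neg hv, if_neg hw]
      ring
  · intro hx
    -- A surviving resonant vertex is isolated in the reduced graph, so adjacency involves only
    -- non-resonant vertices, where the relation says that this quotient is constant.
    let y₀ : ((Γ.deletedVertices χ)ᶜ : Set V) → F := fun v => x v / Γ.vertexFactor χ τ v
    have hadj : ∀ v w, (Γ.reducedGraph χ K).Adj v w → y₀ v = y₀ w := by
      intro v w h
      obtain ⟨h, hdel'⟩ := Γ.reducedGraph_adj.1 h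
      have hrel := (hx v w h).resolve_left fun h' => hdel' (Or.inl h')
      have hv : (v : V) ∉ Γ.resonantVertices χ := fun hv => by
        by_cases hw : (w : V) ∈ Γ.resonantVertices χ
        · refine hdel' (Or.inr fun z hz => ?_)
          rcases Sym2.mem_iff.1 hz with rfl | rfl <;> assumption
        · exact v.2 (hdel v w h hv hw)
      have hw : (w : V) ∉ Γ.resonantVertices χ := fun hw => w.2 (hdel w v h.symm hw hv)
      have hv0 := Γ.vertexFactor_ne_zero hτ v
      have hw0 := Γ.vertexFactor_ne_zero hτ w
      simp only [y₀]
      rw [div_eq_div_iff hv0 hw0, vertexFactor, vertexFactor, if_neg hv, if_neg hw]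
      linear_combination hrel
    have hreach : ∀ v w, (Γ.reducedGraph χ K).Reachable v w → y₀ v = y₀ w := by
      rintro v w ⟨p⟩
      induction p with
      | nil => rfl
      | cons h _ ih => exact (hadj _ _ h).trans ih
    let y : (Γ.reducedGraph χ K).ConnectedComponent → F := Quot.lift y₀ hreach
    refine ⟨y, funext fun v => ?_⟩
    by_cases hv : v ∈ Γ.deletedVertices χ
    · rw [Γ.componentValues_apply_of_mem _ _ _ hv]
      obtain ⟨hv, w, hw, h⟩ := hv
      -- The edge weight is `m_v + m_w = m_w ≠ 0`, so this edge is not resonant and its relation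
      -- forces `x v = 0`.
      have hrel := (hx v w h).resolve_left fun h' => hw (by
        have h2 := h'.2.1
        rw [edgeWeight_mk, show Γ.vertexWeight χ v = 0 from hv, zero_add] at h2
        exact h2)
      rw [h1 v hv, zero_mul] at hrel
      refine ((mul_eq_zero.1 hrel).resolve_left ?_).symm
      rw [sub_eq_zero, eq_comm, Units.val_eq_one, hτ]
      exact hw
    · rw [componentValues_apply _ _ _ _ hv]
      exact div_mul_cancel₀ _ (Γ.vertexFactor_ne_zero hτ v)

/-- The crossed homomorphisms form a space of dimension the number of components of the reduced
graph. -/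
theorem finrank_crossedHoms_unitCharacter [Finite V] [Algebra K F] (hΓ : Γ.IsEven)
    {e : Γ.ArtinGroup →* Multiplicative ℤ} {c : Multiplicative ℤ} (hc : c ≠ 1)
    (he : ∀ x, χ x = c ^ (e x).toAdd) {u : Fˣ} (hu : ∀ n : ℤ, u ^ n = 1 → n = 0) :
    Module.finrank F (crossedHoms (unitCharacter u e)) =
      Nat.card (Γ.reducedGraph χ K).ConnectedComponent := by
  have hweight : ∀ v, Γ.vertexWeight χ v = (e (Γ.gen v)).toAdd * c.toAdd := fun v => by
    rw [vertexWeight, he]; simp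
  have hc' : c.toAdd ≠ 0 := hc
  have hτ : ∀ v, unitCharacter u e (Γ.gen v) = 1 ↔ v ∈ Γ.resonantVertices χ := by
    intro v
    rw [unitCharacter_apply]
    change _ ↔ Γ.vertexWeight χ v = 0
    rw [hweight, mul_eq_zero, or_iff_left hc']
    exact ⟨hu _, fun h => by rw [h, zpow_zero]⟩
  have hrange : LinearMap.range (Γ.crossedHomValues (unitCharacter u e)) =
      LinearMap.range (Γ.componentValues K χ (unitCharacter u e)) := by
    ext x
    rw [Γ.mem_range_crossedHomValues_iff _ hΓ, Γ.mem_range_componentValues_iff hτ]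
    refine forall_congr' fun v => forall_congr' fun w => forall_congr' fun h =>
      or_congr_left ?_
    -- This makes the half label nonzero, as the geometric sum criterion requires.
    have h2 := Γ.two_le_label ⟨s(v, w), h⟩
    rw [unitCharacter_apply, unitCharacter_apply, ← zpow_add,
      Units.geom_sum_zpow_eq_zero_iff hu _ (by omega), ← map_natCast (algebraMap K F),
      FaithfulSMul.algebraMap_eq_zero_iff]
    have hsum : Γ.edgeWeight χ s(v, w) = 0 ↔
        (e (Γ.gen v)).toAdd + (e (Γ.gen w)).toAdd = 0 := by
      rw [edgeWeight_mk, hweight, hweight, ← add_mul, mul_eq_zero, or_iff_left hc']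
    rw [← hsum]
    exact ⟨fun h' => ⟨h, h'⟩, fun ⟨_, h'⟩ => h'⟩
  have : Fintype (Γ.reducedGraph χ K).ConnectedComponent := Fintype.ofFinite _
  rw [← LinearMap.finrank_range_of_inj (Γ.crossedHomValues_injective _), hrange,
    LinearMap.finrank_range_of_inj (Γ.componentValues_injective hτ),
    Module.finrank_fintype_fun_eq_card, Nat.card_eq_fintype_card]

end LabeledGraph

/-! ### Comparison of the two dimension counts -/

theorem LaurentPolynomial.T_injective {R : Type*} [Semiring R] [Nontrivial R] :
    Function.Injective (LaurentPolynomial.T : ℤ → LaurentPolynomial R) :=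
  AddMonoidAlgebra.single_left_injective one_ne_zero

open LaurentPolynomial KernelHomology in
theorem mainTheorem4 {V K : Type u} [Finite V] [Field K] (Γ : LabeledGraph V) (hΓ : Γ.IsEven)
    (χ : Γ.ArtinGroup →* Multiplicative ℤ) (hχ : χ ≠ 1)
    (g : Γ.ArtinGroup) (hg : Subgroup.zpowers (χ g) = χ.range) :
    Module.Finite (LaurentPolynomial K) (KernelHomology χ K g 1) ∧
    Module.Free (LaurentPolynomial K)
      (KernelHomology χ K g 1 ⧸
        Submodule.torsion (LaurentPolynomial K) (KernelHomology χ K g 1)) ∧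
    Module.finrank (LaurentPolynomial K)
      (KernelHomology χ K g 1 ⧸
        Submodule.torsion (LaurentPolynomial K) (KernelHomology χ K g 1)) =
      Module.finrank K (SimpleGraph.ReducedHomologyZero (Γ.reducedGraph χ K) K) ∧
    (Module.IsTorsion (LaurentPolynomial K) (KernelHomology χ K g 1) ↔
      (Γ.reducedGraph χ K).Connected) := by
  have hfin : Module.Finite (LaurentPolynomial K) (KernelHomology χ K g 1) :=
    KernelHomology.finite K hχ hg
  let F := FractionRing (LaurentPolynomial K)
  obtain ⟨E⟩ := nonempty_hom_linearEquiv (LaurentPolynomial K) (KernelHomology χ K g 1) F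
  have hfinHom : Module.Finite F (KernelHomology χ K g 1 →ₗ[LaurentPolynomial K] F) :=
    Module.Finite.equiv E.symm
  have hT : Function.Injective fun n : ℤ => algebraMap (LaurentPolynomial K) F (T n) :=
    (IsFractionRing.injective (LaurentPolynomial K) F).comp T_injective
  -- The image of `t`; it has infinite order because distinct powers of `t` stay distinct in `F`.
  let u : Fˣ := ((isUnit_T (R := K) 1).map (algebraMap (LaurentPolynomial K) F)).unit
  have hu : ∀ n : ℤ, ((u ^ n : Fˣ) : F) = algebraMap (LaurentPolynomial K) F (T n) :=
    fun n => (algebraMap_T rfl n).symm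
  have hu' : ∀ n : ℤ, u ^ n = 1 → n = 0 := by
    intro n hn
    refine hT ?_
    simp only
    rw [← hu, hn, T_zero, map_one, Units.val_one]
  have hu1 : (u : F) ≠ 1 := fun h => one_ne_zero (hu' 1 (by rw [zpow_one]; exact Units.ext h))
  obtain ⟨e, he, heg⟩ := exists_exponent hχ hg
  have h1 := finrank_crossedHoms K hχ hg he heg (u := u) (F := F) rfl hu1
  rw [Γ.finrank_crossedHoms_unitCharacter (K := K) χ hΓ (apply_ne_one hχ hg) he hu',
    E.finrank_eq, Module.finrank_fin_fun] at h1
  -- As `χ ≠ 1`, some vertex is non-resonant and survives, so the augmentation is onto and reduced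
  -- `H₀` loses exactly one dimension.
  have := Γ.nonempty_compl_deletedVertices hχ
  have h2 := (Γ.reducedGraph χ K).finrank_reducedHomologyZero_add_one K
  refine ⟨hfin, inferInstance, by omega, ?_⟩
  rw [isTorsion_iff_finrank_quotient_torsion_eq_zero,
    SimpleGraph.connected_iff_card_connectedComponent]
  omega

end
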